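/- Let $N\ge 2$ and let $\Omega\subset\mathbb R^N$ be a bounded domain with smooth boundary. Put $$\lambda_1(\Omega)=\inf_{u\in W^{1,1}(\Omega)\setminus W^{1,1}_0(\Omega)}\frac{\int_\Omega|\nabla u|\,dx+\int_\Omega|u|\,dx}{\int_{\partial\Omega}|u|\,dH^{N-1}},$$ where $W^{1,1}_0(\Omega)$ is the closure of $C_c^\infty(\Omega)$ in $W^{1,1}(\Omega)$, the values of $u$ on $\partial\Omega$ are those of its trace, and $H^{N-1}$ is the $(N-1)$-dimensional Hausdorff measure (normalized to agree with surface area). Call $x_0\in\partial\Omega$ a *good point* if the following holds. The principal curvatures $\lambda_1,\dots,\lambda_{N-1}$ of $\partial\Omega$ at $x_0$ (with the sign for which spheres bounding balls have positive curvatures) are all positive and satisfy $\sum_{i=1}^{N-1}\lambda_i>1$; moreover there are Euclidean coordinates $(y,t)\in\mathbb R^{N-1}\times\mathbb R$ centred at $x_0$, with the $t$-axis along the inner normal and the $y_i$-axes along principal directions, a radius $r>0$ and a smooth function $\rho$ such that $$\Omega\cap B_r=\{(y,t)\in B_r:\ t>\rho(y)\},\qquad \partial\Omega\cap B_r=\{(y,t)\in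 B_r:\ t=\rho(y)\},$$ such that, with $|y|_\lambda^2=\sum_{i=1}^{N-1}\lambda_iy_i^2$, one has $\rho(y)=\tfrac12|y|_\lambda^2\,(1+O(|y|^\alpha))$ as $y\to0$ for some $\alpha>0$, and such that $$\bigl|\{y:\ |y|<r,\ \rho(y)\le\varepsilon^2/2\}\,\Delta\,\{y:\ |y|_\lambda\le\varepsilon\}\bigr|=o(\varepsilon^{N+1})\qquad(\varepsilon\to0^+),$$ where $\Delta$ is the symmetric difference and $|\cdot|$ is Lebesgue measure on $\mathbb R^{N-1}$. **Theorem.** If $\partial\Omega$ has a good point, then $\lambda_1(\Omega)<1$. -/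

import Mathlib

open MeasureTheory Filter Topology Asymptotics
open scoped ContDiff ENNReal

noncomputable section

/-- Euclidean space `ℝ^d`. -/
abbrev Euc (d : ℕ) : Type := EuclideanSpace ℝ (Fin d)

/-- `ℝ^n × ℝ` with its Euclidean norm: points `(y, t)` of a local coordinate system of
`ℝ^(n+1)`. -/
abbrev EucProd (n : ℕ) : Type := WithLp 2 (Euc n × ℝ)

/-! ### The Sobolev space `W^{1,1}`, traces, and the best trace constant -/

/-- Smooth functions with compact support contained in `Ω`. -/
def IsTestFunction {d : ℕ} (Ω : Set (Euc d)) (φ : Euc d → ℝ) : Prop :=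
  ContDiff ℝ ∞ φ ∧ HasCompactSupport φ ∧ tsupport φ ⊆ Ω

/-- `u ∈ W^{1,1}(Ω)` with weak gradient `G`: both are integrable on `Ω`, and
`∫_Ω u ∂_v φ = - ∫_Ω ⟨G, v⟩ φ` for all test functions `φ` and all directions `v`. -/
def MemW11 {d : ℕ} (Ω : Set (Euc d)) (u : Euc d → ℝ) (G : Euc d → Euc d) : Prop :=
  IntegrableOn u Ω ∧ IntegrableOn G Ω ∧
    ∀ φ : Euc d → ℝ, IsTestFunction Ω φ → ∀ v : Euc d,
      ∫ x in Ω, u x * fderiv ℝ φ x v = -∫ x in Ω, inner ℝ (G x) v * φ x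

/-- The `W^{1,1}` norm `∫_Ω |∇u| + ∫_Ω |u|` of a function `u` with weak gradient `G`. -/
def normW11 {d : ℕ} (Ω : Set (Euc d)) (u : Euc d → ℝ) (G : Euc d → Euc d) : ℝ≥0∞ :=
  (∫⁻ x in Ω, ‖G x‖ₑ) + ∫⁻ x in Ω, ‖u x‖ₑ

/-- `u ∈ W_0^{1,1}(Ω)`: `u` (with weak gradient `G`) lies in `W^{1,1}(Ω)` and in the closure of the
smooth functions with compact support in `Ω` for the `W^{1,1}` norm. -/
def MemW11Zero {d : ℕ} (Ω : Set (Euc d)) (u : Euc d → ℝ) (G : Euc d → Euc d) : Prop :=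
  MemW11 Ω u G ∧ ∀ ε : ℝ≥0∞, 0 < ε → ∃ φ : Euc d → ℝ, IsTestFunction Ω φ ∧
    normW11 Ω (fun x => u x - φ x) (fun x => G x - gradient φ x) < ε

/-- `g` is the trace of `u` on `∂Ω`, for `Ω ⊆ ℝ^(n+1)`: for `H^n`-almost every `x ∈ ∂Ω`, the mean of
`|u - g(x)|` over `Ω ∩ B(x, r)` tends to `0` as `r → 0`. Here `μHE[n]` is the `n`-dimensional
Hausdorff measure, normalized so that it agrees with Lebesgue measure on `ℝ^n`. -/
def IsTrace {n : ℕ} (Ω : Set (Euc (n + 1))) (u g : Euc (n + 1) → ℝ) : Prop :=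
  ∀ᵐ x ∂(μHE[n] : Measure (Euc (n + 1))).restrict (frontier Ω),
    Tendsto (fun r : ℝ => ⨍ z in Ω ∩ Metric.ball x r, |u z - g x|) (𝓝[>] 0) (𝓝 0)

/-- The best trace constant `λ_1(Ω)`: the infimum over `u ∈ W^{1,1}(Ω) \ W_0^{1,1}(Ω)` of
`(∫_Ω |∇u| + ∫_Ω |u|) / ∫_{∂Ω} |u| dH^n`. The quotient is taken in `[0, ∞]`, where a quotient
of a positive number by `0` is `∞`. -/
def lambdaOne {n : ℕ} (Ω : Set (Euc (n + 1))) : ℝ≥0∞ :=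
  ⨅ (u : Euc (n + 1) → ℝ) (G : Euc (n + 1) → Euc (n + 1)) (g : Euc (n + 1) → ℝ)
    (_ : MemW11 Ω u G) (_ : ¬ MemW11Zero Ω u G) (_ : IsTrace Ω u g),
    normW11 Ω u G / ∫⁻ x in frontier Ω, ‖g x‖ₑ ∂(μHE[n] : Measure (Euc (n + 1)))

/-! ### Smooth domains and good points -/

/-- In the Euclidean coordinates `Φ z = (y, t)` centred at `x`, inside the ball `B(x, r)`, the set
`Ω` is `{t > ρ(y)}` and its boundary is the graph `{t = ρ(y)}` of the smooth function `ρ`.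
(Only the values of `ρ` near `0` matter, and every smooth germ has a global smooth
representative.) -/
def IsLocalGraph {n : ℕ} (Ω : Set (Euc (n + 1))) (x : Euc (n + 1))
    (Φ : Euc (n + 1) ≃ᵃⁱ[ℝ] EucProd n) (ρ : Euc n → ℝ) (r : ℝ) : Prop :=
  Φ x = 0 ∧ 0 < r ∧ ContDiff ℝ ∞ ρ ∧
    ∀ z ∈ Metric.ball x r,
      (z ∈ Ω ↔ ρ (Φ z).fst < (Φ z).snd) ∧ (z ∈ frontier Ω ↔ ρ (Φ z).fst = (Φ z).snd)

/-- A bounded smooth domain: a bounded connected nonempty open set which, near each point of its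
boundary, lies on one side of the graph of a smooth function and is bounded by that graph. -/
def IsBoundedSmoothDomain {n : ℕ} (Ω : Set (Euc (n + 1))) : Prop :=
  IsOpen Ω ∧ IsConnected Ω ∧ Bornology.IsBounded Ω ∧
    ∀ x ∈ frontier Ω, ∃ Φ ρ r, IsLocalGraph Ω x Φ ρ r

/-- The quadratic form `|y|_κ² = ∑ κ_i y_i²`. -/
def quadForm {n : ℕ} (κ : Fin n → ℝ) (y : Euc n) : ℝ := ∑ i, κ i * y i ^ 2

/-- The coordinates `y` of a local graph representation at `x` are principal coordinates, and the
`κ i` are the principal curvatures of `∂Ω` at `x`: the tangent space at `x` is `{t = 0}`, and the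
Hessian of `ρ` at `0` is diagonal with entries `κ i`. As `Ω` is `{t > ρ(y)}`, the boundary of a
ball has positive principal curvatures. -/
def IsPrincipal {n : ℕ} (ρ : Euc n → ℝ) (κ : Fin n → ℝ) : Prop :=
  fderiv ℝ ρ 0 = 0 ∧ ∀ v w : Euc n, fderiv ℝ (fderiv ℝ ρ) 0 v w = ∑ i, κ i * v i * w i

/-- `x ∈ ∂Ω` is a good point: the principal curvatures `κ_i` of `∂Ω` at `x` are positive, their sum
is larger than `1`, and the graph of `∂Ω` over its tangent space at `x` is close to the osculating
paraboloid: `ρ(y) = (1/2) |y|_κ² (1 + O(|y|^α))` for some `α > 0`, and, with `N = n + 1`,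
`|{ρ ≤ ε²/2} Δ {|y|_κ ≤ ε}| = o(ε^(N+1))` as `ε → 0` (`ρ` being taken near `0` only). -/
def IsGoodPoint {n : ℕ} (Ω : Set (Euc (n + 1))) (x : Euc (n + 1)) : Prop :=
  x ∈ frontier Ω ∧
  ∃ (Φ : Euc (n + 1) ≃ᵃⁱ[ℝ] EucProd n) (ρ : Euc n → ℝ) (r : ℝ) (κ : Fin n → ℝ),
    IsLocalGraph Ω x Φ ρ r ∧ IsPrincipal ρ κ ∧
    (∀ i, 0 < κ i) ∧ 1 < ∑ i, κ i ∧
    (∃ α : ℝ, 0 < α ∧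
      (fun y => ρ y - 1 / 2 * quadForm κ y) =O[𝓝 0] fun y => quadForm κ y * ‖y‖ ^ α) ∧
    (fun ε : ℝ => volume.real (symmDiff {y : Euc n | y ∈ Metric.ball 0 r ∧ ρ y ≤ ε ^ 2 / 2}
        {y : Euc n | √(quadForm κ y) ≤ ε}))
      =o[𝓝[>] 0] fun ε : ℝ => ε ^ (n + 2)

end

/-! At a good point the boundary is a graph `t = ρ(y)` whose mean curvature `H` exceeds `1` at the
point, hence nearby by continuity. Raising such a graph into `Ω` loses area faster than it sweeps
out volume, and a function living in the thin layer between the old and the raised graph turns this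
into a bound on the trace quotient.

Take a bump `φ ≥ 0` supported where `H > 1`, and let `u` be a cut-off of the square of the positive
part of `p = φ(y) - (t - ρ(y)) / δ`. On the boundary graph `u = φ²`. The gradient of `p` has length
`√(1 + |∇ρ + δ∇φ|²) / δ`, which does not depend on `t`, so integration along vertical lines bounds
the numerator by `∫ φ² √(1 + |∇ρ + δ∇φ|²) + δ φ³ / 3` (`lintegral_fiber_le`,
`lintegral_graphLayer_le`). Expanding in `δ` and integrating by parts against `∇ρ / √(1 + |∇ρ|²)`,
whose divergence is `H`, this is at most `∫ φ² √(1 + |∇ρ|²) - δ ∫ (H - 1) φ³ / 3 + O(δ²)`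
(`eventually_integral_area_lt`).

The denominator is at least `∫ φ² √(1 + |∇ρ|²)`. Only this half of the area formula is needed, and
it follows from the fact that orthogonal projections onto hyperplanes do not increase Hausdorff
measure (`lintegral_graph_le`). For small `δ` the quotient is therefore below `1`. -/

noncomputable section

/-! ### A lower bound for the area of a graph -/

section GraphArea

variable {n : ℕ}

/-- The linear map `w ↦ (I + g gᵀ)^(-1/2) w`. -/
def invSqrtRankOne (g : Euc n) : Euc n →L[ℝ] Euc n :=
  ContinuousLinearMap.id ℝ (Euc n) +
    (-(1 / (√(1 + ‖g‖ ^ 2) * (1 + √(1 + ‖g‖ ^ 2)))) • innerSL ℝ g).smulRight g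

theorem invSqrtRankOne_apply (g w : Euc n) :
    invSqrtRankOne g w =
      w - (inner ℝ g w / (√(1 + ‖g‖ ^ 2) * (1 + √(1 + ‖g‖ ^ 2)))) • g := by
  simp only [invSqrtRankOne, add_apply, ContinuousLinearMap.id_apply,
    ContinuousLinearMap.smulRight_apply, smul_apply, innerSL_apply_apply,
    smul_eq_mul, sub_eq_add_neg, ← neg_smul]
  congr 2
  ring

/-- The map is symmetric and its square is `(I + g gᵀ)⁻¹ = I - g gᵀ / (1 + |g|²)`. -/
theorem norm_invSqrtRankOne_sq (g w : Euc n) :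
    ‖invSqrtRankOne g w‖ ^ 2 = ‖w‖ ^ 2 - inner ℝ g w ^ 2 / (1 + ‖g‖ ^ 2) := by
  have ha : √(1 + ‖g‖ ^ 2) ^ 2 = 1 + ‖g‖ ^ 2 := Real.sq_sqrt (by positivity)
  have ha0 : 0 < √(1 + ‖g‖ ^ 2) := Real.sqrt_pos.2 (by positivity)
  rw [invSqrtRankOne_apply, norm_sub_sq_real, inner_smul_right, norm_smul, mul_pow,
    Real.norm_eq_abs, sq_abs, real_inner_comm]
  have hg : ‖g‖ ^ 2 = √(1 + ‖g‖ ^ 2) ^ 2 - 1 := by linarith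
  generalize √(1 + ‖g‖ ^ 2) = a at *
  rw [hg]
  have : (1 + a) ≠ 0 := by positivity
  field_simp
  ring

/-- A rank-one perturbation of the identity has determinant `1 + f v`. -/
theorem det_id_add_smulRight (f : Euc n →L[ℝ] ℝ) (v : Euc n) :
    (ContinuousLinearMap.id ℝ (Euc n) + f.smulRight v).det = 1 + f v := by
  have h : ((ContinuousLinearMap.id ℝ (Euc n) + f.smulRight v : Euc n →L[ℝ] Euc n) :
      Euc n →ₗ[ℝ] Euc n) = LinearMap.transvection (f : Module.Dual ℝ (Euc n)) v := by
    ext w : 1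
    simp [LinearMap.transvection.apply]
  rw [ContinuousLinearMap.det, h, LinearMap.transvection.det]
  rfl

theorem det_invSqrtRankOne (g : Euc n) : (invSqrtRankOne g).det = 1 / √(1 + ‖g‖ ^ 2) := by
  have ha : √(1 + ‖g‖ ^ 2) ^ 2 = 1 + ‖g‖ ^ 2 := Real.sq_sqrt (by positivity)
  have ha0 : 0 < √(1 + ‖g‖ ^ 2) := Real.sqrt_pos.2 (by positivity)
  rw [invSqrtRankOne, det_id_add_smulRight]
  simp only [smul_apply, innerSL_apply_apply, smul_eq_mul,
    real_inner_self_eq_norm_sq]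
  have hg : ‖g‖ ^ 2 = √(1 + ‖g‖ ^ 2) ^ 2 - 1 := by linarith
  generalize √(1 + ‖g‖ ^ 2) = a at *
  rw [hg]
  have : (1 + a) ≠ 0 := by positivity
  field_simp
  ring

theorem invSqrtRankOne_injective (g : Euc n) : Function.Injective (invSqrtRankOne g) := by
  rw [injective_iff_map_eq_zero]
  intro w hw
  have h := norm_invSqrtRankOne_sq g w
  have hc : inner ℝ g w ^ 2 ≤ ‖g‖ ^ 2 * ‖w‖ ^ 2 := by
    rw [← mul_pow]
    exact sq_le_sq' (neg_le_of_abs_le (abs_real_inner_le_norm g w)) (real_inner_le_norm g w)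
  rw [hw, norm_zero] at h
  have h1 : (0 : ℝ) < 1 + ‖g‖ ^ 2 := by positivity
  have h2 : ‖w‖ ^ 2 * (1 + ‖g‖ ^ 2) = inner ℝ g w ^ 2 := by
    field_simp at h
    linarith
  have : ‖w‖ ^ 2 ≤ 0 := by nlinarith
  exact norm_eq_zero.1 (pow_eq_zero_iff two_ne_zero |>.1 (le_antisymm this (by positivity)))

/-- The orthogonal projection of `ℝ^n × ℝ` onto the hyperplane `{t = ⟪g, y⟫}`, identified
with `ℝ^n`. -/
def hyperplaneProj (g : Euc n) (z : EucProd n) : Euc n := invSqrtRankOne g (z.fst + z.snd • g)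

/-- For `z = (y, t)` the squared norm drops by exactly `(t - ⟪g, y⟫)² / (1 + |g|²)`, the squared
distance of `z` to the hyperplane. -/
theorem lipschitzWith_hyperplaneProj (g : Euc n) : LipschitzWith 1 (hyperplaneProj g) := by
  refine LipschitzWith.of_dist_le_mul fun z w => ?_
  have h : hyperplaneProj g z - hyperplaneProj g w =
      invSqrtRankOne g ((z - w).fst + (z - w).snd • g) := by
    simp only [hyperplaneProj, ← map_sub, WithLp.sub_fst, WithLp.sub_snd, sub_smul]
    congr 1
    abel
  rw [dist_eq_norm, dist_eq_norm, h, NNReal.coe_one, one_mul]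
  refine le_of_sq_le_sq ?_ (norm_nonneg _)
  generalize z - w = v
  rw [norm_invSqrtRankOne_sq, WithLp.prod_norm_sq_eq_of_L2, norm_add_sq_real, inner_add_right,
    inner_smul_right, inner_smul_right, norm_smul, mul_pow, Real.norm_eq_abs, sq_abs,
    real_inner_self_eq_norm_sq, real_inner_comm]
  generalize inner ℝ g v.fst = p
  generalize v.snd = t
  have h1 : (0 : ℝ) < 1 + ‖g‖ ^ 2 := by positivity
  rw [sub_le_iff_le_add, ← sub_le_iff_le_add', le_div_iff₀ h1]
  nlinarith [sq_nonneg (t - p)]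

/-- The graph map `y ↦ (y, ρ y)`. -/
def graphMap (ρ : Euc n → ℝ) (y : Euc n) : EucProd n := WithLp.toLp 2 (y, ρ y)

theorem isClosedEmbedding_graphMap {ρ : Euc n → ℝ} (hρ : Continuous ρ) :
    Topology.IsClosedEmbedding (graphMap ρ) := by
  refine Function.LeftInverse.isClosedEmbedding (f := fun z : EucProd n => z.fst)
    (fun y => rfl) ?_ ?_
  · fun_prop
  · unfold graphMap; fun_prop

theorem hasFDerivAt_hyperplaneProj_graphMap {ρ : Euc n → ℝ} (hρ : Differentiable ℝ ρ)
    (g y : Euc n) :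
    HasFDerivAt (fun y => hyperplaneProj g (graphMap ρ y))
      ((invSqrtRankOne g).comp
        (ContinuousLinearMap.id ℝ (Euc n) + (fderiv ℝ ρ y).smulRight g)) y := by
  refine (invSqrtRankOne g).hasFDerivAt.comp y (f := fun y => y + ρ y • g) ?_
  exact (hasFDerivAt_id y).add ((hρ y).hasFDerivAt.smul_const g)

/-- If `y` and `z` have the same image, then `z - y` is a multiple of `g` and `|z - y| ≤ |ρ z - ρ y|
≤ c |z - y|` with `c < 1`. -/
theorem injOn_hyperplaneProj_graphMap {ρ : Euc n → ℝ} (hρ : Differentiable ℝ ρ) {s : Set (Euc n)}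
    (hs : Convex ℝ s) {c : ℝ} (hc : c < 1) (hsc : ∀ y ∈ s, ‖fderiv ℝ ρ y‖ ≤ c) {g : Euc n}
    (hg : ‖g‖ ≤ 1) : Set.InjOn (fun y => hyperplaneProj g (graphMap ρ y)) s := by
  intro y hy z hz h
  have h1 : y + ρ y • g = z + ρ z • g := invSqrtRankOne_injective g h
  have h2 : z - y = -((ρ z - ρ y) • g) := by
    rw [sub_smul, ← sub_eq_zero]
    rw [← sub_eq_zero] at h1
    rw [← neg_eq_zero, ← h1]
    abel
  have h3 := hs.norm_image_sub_le_of_norm_fderiv_le (fun x _ => hρ x) hsc hy hz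
  have h4 : ‖z - y‖ ≤ ‖ρ z - ρ y‖ := by
    rw [h2, norm_neg, norm_smul]
    exact mul_le_of_le_one_right (norm_nonneg _) hg
  have h5 : ‖z - y‖ ≤ 0 := by
    by_contra hpos
    push Not at hpos
    nlinarith [norm_nonneg (ρ z - ρ y)]
  exact (sub_eq_zero.1 (norm_le_zero_iff.1 h5)).symm

theorem LipschitzWith.euclideanHausdorffMeasure_image_le {X Y : Type*} [EMetricSpace X]
    [MeasurableSpace X] [BorelSpace X] [EMetricSpace Y] [MeasurableSpace Y] [BorelSpace Y]
    {f : X → Y} (hf : LipschitzWith 1 f) (d : ℕ) (s : Set X) : μHE[d] (f '' s) ≤ μHE[d] s := by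
  simp only [Measure.euclideanHausdorffMeasure_def, Measure.smul_apply]
  gcongr
  simpa using hf.hausdorffMeasure_image_le (d := d) (by positivity) s

/-- Project the graph onto the hyperplane of slope `g`. The left side is the volume of the image by
change of variables, and a 1-Lipschitz map does not increase Hausdorff measure. For `g = ∇ρ(y)` the
integrand at `y` becomes `√(1 + |∇ρ|²)`, so no area is lost to first order when the slope is chosen
pointwise. -/
theorem lintegral_tilted_le_measure_graph {ρ : Euc n → ℝ} (hρ : Differentiable ℝ ρ)
    {s : Set (Euc n)} (hs : Convex ℝ s) {c : ℝ} (hc : c < 1) (hsc : ∀ y ∈ s, ‖fderiv ℝ ρ y‖ ≤ c)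
    {g : Euc n} (hg : ‖g‖ ≤ 1) {A : Set (Euc n)} (hA : MeasurableSet A) (hAs : A ⊆ s) :
    ∫⁻ y in A, ENNReal.ofReal |(1 / √(1 + ‖g‖ ^ 2)) * (1 + inner ℝ (gradient ρ y) g)| ≤
      μHE[n] (graphMap ρ '' A) := by
  have h := lintegral_abs_det_fderiv_eq_addHaar_image volume hA
    (fun y _ => (hasFDerivAt_hyperplaneProj_graphMap hρ g y).hasFDerivWithinAt)
    ((injOn_hyperplaneProj_graphMap hρ hs hc hsc hg).mono hAs)
  have hdet : ∀ y, ((invSqrtRankOne g).comp (ContinuousLinearMap.id ℝ (Euc n) +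
      (fderiv ℝ ρ y).smulRight g)).det =
        (1 / √(1 + ‖g‖ ^ 2)) * (1 + inner ℝ (gradient ρ y) g) := by
    intro y
    rw [inner_gradient_left, ← det_invSqrtRankOne, ← det_id_add_smulRight]
    exact LinearMap.det_comp _ _
  simp only [hdet] at h
  rw [h, ← EuclideanSpace.euclideanHausdorffMeasure_eq_volume, ← Set.image_image]
  exact (lipschitzWith_hyperplaneProj g).euclideanHausdorffMeasure_image_le n _

theorem measure_eq_sum_simpleFunc {α β : Type*} [MeasurableSpace α] (μ : Measure α)
    (f : SimpleFunc α β) {A : Set α} (hA : MeasurableSet A) :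
    μ A = ∑ b ∈ f.range, μ (A ∩ f ⁻¹' {b}) := by
  rw [← measure_biUnion_finset]
  · congr 1
    ext x
    simp
  · intro b _ b' _ hb
    refine Set.disjoint_left.2 fun x hx hx' => hb ?_
    exact hx.2.symm.trans hx'.2
  · exact fun b _ => hA.inter (f.measurableSet_fiber b)

/-- The constant-slope bound applies on each fibre of `g`. Both sides are measures in `A`, the right
one because the graph map is a measurable embedding, so the bounds add up. -/
theorem lintegral_simpleFunc_tilted_le_measure_graph {ρ : Euc n → ℝ} (hρ : ContDiff ℝ 1 ρ)
    {s : Set (Euc n)} (hs : Convex ℝ s) {c : ℝ} (hc : c < 1) (hsc : ∀ y ∈ s, ‖fderiv ℝ ρ y‖ ≤ c)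
    (g : SimpleFunc (Euc n) (Euc n)) (hg : ∀ y, ‖g y‖ ≤ 1) {A : Set (Euc n)}
    (hA : MeasurableSet A) (hAs : A ⊆ s) :
    ∫⁻ y in A, ENNReal.ofReal |(1 / √(1 + ‖g y‖ ^ 2)) * (1 + inner ℝ (gradient ρ y) (g y))| ≤
      μHE[n] (graphMap ρ '' A) := by
  have hd := hρ.differentiable one_ne_zero
  have hΓ := (isClosedEmbedding_graphMap hρ.continuous).measurableEmbedding
  rw [← hΓ.comap_apply, measure_eq_sum_simpleFunc _ g hA,
    ← withDensity_apply _ hA, measure_eq_sum_simpleFunc _ g hA]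
  refine Finset.sum_le_sum fun b hb => ?_
  have hm := hA.inter (g.measurableSet_fiber b)
  obtain ⟨y₀, rfl⟩ := SimpleFunc.mem_range.1 hb
  rw [hΓ.comap_apply, withDensity_apply _ hm]
  refine le_trans (le_of_eq ?_) (lintegral_tilted_le_measure_graph hd hs hc hsc (hg y₀) hm
    (Set.inter_subset_left.trans hAs))
  refine setLIntegral_congr_fun hm fun y hy => ?_
  have : g y = g y₀ := hy.2
  simp only [this]

/-- The area of the graph of `ρ` over `A` is at least `∫_A √(1 + |∇ρ|²)`. -/
theorem lintegral_sqrt_le_measure_graph {ρ : Euc n → ℝ} (hρ : ContDiff ℝ 1 ρ)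
    {s : Set (Euc n)} (hs : Convex ℝ s) {c : ℝ} (hc : c < 1) (hsc : ∀ y ∈ s, ‖fderiv ℝ ρ y‖ ≤ c)
    {A : Set (Euc n)} (hA : MeasurableSet A) (hAs : A ⊆ s) :
    ∫⁻ y in A, ENNReal.ofReal √(1 + ‖gradient ρ y‖ ^ 2) ≤ μHE[n] (graphMap ρ '' A) := by
  have hgc : Continuous (gradient ρ) :=
    (InnerProductSpace.toDual ℝ (Euc n)).symm.continuous.comp (hρ.continuous_fderiv one_ne_zero)
  -- The values are kept in the closed unit ball, as injectivity of the projections requires; `∇ρ`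
  -- lies there on `A` because `c < 1`.
  let g : ℕ → SimpleFunc (Euc n) (Euc n) := fun k =>
    SimpleFunc.approxOn (gradient ρ) hgc.measurable (Metric.closedBall 0 1) 0 (by simp) k
  have hg : ∀ k y, ‖g k y‖ ≤ 1 := fun k y => by
    simpa using SimpleFunc.approxOn_mem hgc.measurable (s := Metric.closedBall 0 1) (y₀ := 0)
      (by simp) k y
  let J : ℕ → Euc n → ℝ≥0∞ := fun k y =>
    ENNReal.ofReal |(1 / √(1 + ‖g k y‖ ^ 2)) * (1 + inner ℝ (gradient ρ y) (g k y))|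
  have hJm : ∀ k, Measurable (J k) := fun k => by
    have := (g k).measurable
    have := hgc.measurable
    fun_prop
  have hlim : ∀ y ∈ A, Tendsto (fun k => J k y) atTop
      (𝓝 (ENNReal.ofReal √(1 + ‖gradient ρ y‖ ^ 2))) := by
    intro y hy
    have h1 : Tendsto (fun k => g k y) atTop (𝓝 (gradient ρ y)) := by
      refine SimpleFunc.tendsto_approxOn hgc.measurable _ (subset_closure ?_)
      have := hsc y (hAs hy)
      simp only [mem_closedBall_zero_iff, gradient, LinearIsometryEquiv.norm_map]
      linarith
    have hcont : Continuous fun v : Euc n =>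
        ENNReal.ofReal |(1 / √(1 + ‖v‖ ^ 2)) * (1 + inner ℝ (gradient ρ y) v)| := by
      refine ENNReal.continuous_ofReal.comp (Continuous.abs (Continuous.mul ?_ (by fun_prop)))
      exact Continuous.div (by fun_prop) (by fun_prop)
        fun v => (Real.sqrt_pos.2 (by positivity)).ne'
    have h2 := (hcont.tendsto (gradient ρ y)).comp h1
    refine h2.trans_eq (congrArg (fun a => 𝓝 (ENNReal.ofReal a)) ?_)
    rw [real_inner_self_eq_norm_sq, abs_of_nonneg (by positivity)]
    have ha : √(1 + ‖gradient ρ y‖ ^ 2) ^ 2 = 1 + ‖gradient ρ y‖ ^ 2 :=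
      Real.sq_sqrt (by positivity)
    have ha0 : 0 < √(1 + ‖gradient ρ y‖ ^ 2) := Real.sqrt_pos.2 (by positivity)
    rw [← ha, Real.sqrt_sq ha0.le]
    field_simp
  -- Fatou's lemma suffices, since only a lower bound for the area is wanted.
  calc ∫⁻ y in A, ENNReal.ofReal √(1 + ‖gradient ρ y‖ ^ 2)
      = ∫⁻ y in A, liminf (fun k => J k y) atTop :=
        setLIntegral_congr_fun hA fun y hy => (hlim y hy).liminf_eq.symm
    _ ≤ liminf (fun k => ∫⁻ y in A, J k y) atTop := lintegral_liminf_le hJm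
    _ ≤ liminf (fun _ : ℕ => μHE[n] (graphMap ρ '' A)) atTop :=
        liminf_le_liminf (Eventually.of_forall fun k =>
          lintegral_simpleFunc_tilted_le_measure_graph hρ hs hc hsc (g k) (hg k) hA hAs)
    _ = _ := liminf_const _

/-- The integral of `F` over the image of the graph of `ρ` over `s` under an isometry is at least
`∫_s F √(1 + |∇ρ|²)`. -/
theorem lintegral_graph_le {ρ : Euc n → ℝ} (hρ : ContDiff ℝ 1 ρ)
    {s : Set (Euc n)} (hs : Convex ℝ s) (hsm : MeasurableSet s) {c : ℝ} (hc : c < 1)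
    (hsc : ∀ y ∈ s, ‖fderiv ℝ ρ y‖ ≤ c) {X : Type*} [MetricSpace X]
    [MeasurableSpace X] [BorelSpace X] {ι : EucProd n → X} (hι : Isometry ι) {S : Set X}
    (hS : ∀ y ∈ s, ι (graphMap ρ y) ∈ S) {F : X → ℝ≥0∞} (hF : Measurable F) :
    ∫⁻ y in s, ENNReal.ofReal √(1 + ‖gradient ρ y‖ ^ 2) * F (ι (graphMap ρ y)) ≤
      ∫⁻ x in S, F x ∂μHE[n] := by
  have hgc : Continuous (gradient ρ) :=
    (InnerProductSpace.toDual ℝ (Euc n)).symm.continuous.comp (hρ.continuous_fderiv one_ne_zero)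
  have hJ : Measurable fun y => ENNReal.ofReal √(1 + ‖gradient ρ y‖ ^ 2) := by
    have := hgc.measurable
    fun_prop
  have hm : Measurable fun y => ι (graphMap ρ y) :=
    (hι.continuous.comp (isClosedEmbedding_graphMap hρ.continuous).continuous).measurable
  have hle : (((volume.restrict s).withDensity
      fun y => ENNReal.ofReal √(1 + ‖gradient ρ y‖ ^ 2)).map fun y => ι (graphMap ρ y)) ≤
        (μHE[n] : Measure X).restrict S := by
    refine Measure.le_iff.2 fun T hT => ?_
    rw [Measure.map_apply hm hT, withDensity_apply _ (hm hT), Measure.restrict_restrict (hm hT),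
      Measure.restrict_apply hT]
    refine (lintegral_sqrt_le_measure_graph hρ hs hc hsc ((hm hT).inter hsm)
      Set.inter_subset_right).trans ?_
    rw [← hι.euclideanHausdorffMeasure_image]
    refine measure_mono ?_
    rintro _ ⟨_, ⟨y, hy, rfl⟩, rfl⟩
    exact ⟨hy.1, hS y hy.2⟩
  refine le_trans (le_of_eq ?_) (lintegral_mono' hle le_rfl)
  rw [lintegral_map hF hm]
  exact (lintegral_withDensity_eq_lintegral_mul _ hJ (hF.comp hm)).symm

end GraphArea

/-! ### First variation of the area -/

section FirstVariation

variable {n : ℕ}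

theorem ContDiff.gradient_top {ρ : Euc n → ℝ} (hρ : ContDiff ℝ ∞ ρ) :
    ContDiff ℝ ∞ (gradient ρ) :=
  (InnerProductSpace.toDual ℝ (Euc n)).symm.contDiff.comp
    (hρ.fderiv_right (m := ∞) (by simp))

theorem norm_gradient (f : Euc n → ℝ) (y : Euc n) : ‖gradient f y‖ = ‖fderiv ℝ f y‖ := by
  simp [gradient]

theorem contDiff_inv_sqrt_one_add_gradient {ρ : Euc n → ℝ} (hρ : ContDiff ℝ ∞ ρ) :
    ContDiff ℝ ∞ fun y => (√(1 + ‖gradient ρ y‖ ^ 2))⁻¹ :=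
  ((contDiff_const.add (hρ.gradient_top.norm_sq ℝ)).sqrt fun y => by positivity).inv
    fun y => (Real.sqrt_pos.2 (by positivity)).ne'

/-- The `i`-th component of `∇ρ / √(1 + |∇ρ|²)`. -/
def unitSlope (ρ : Euc n → ℝ) (i : Fin n) (y : Euc n) : ℝ :=
  fderiv ℝ ρ y (EuclideanSpace.single i 1) * (√(1 + ‖gradient ρ y‖ ^ 2))⁻¹

/-- The mean curvature of the graph of `ρ` (the sum of the principal curvatures),
as the divergence of `∇ρ / √(1 + |∇ρ|²)`. -/
def graphMeanCurvature (ρ : Euc n → ℝ) (y : Euc n) : ℝ :=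
  ∑ i, fderiv ℝ (unitSlope ρ i) y (EuclideanSpace.single i 1)

theorem contDiff_fderiv_apply {ρ : Euc n → ℝ} (hρ : ContDiff ℝ ∞ ρ) (v : Euc n) :
    ContDiff ℝ ∞ fun y => fderiv ℝ ρ y v :=
  (hρ.fderiv_right (m := ∞) (by simp)).clm_apply contDiff_const

theorem contDiff_unitSlope {ρ : Euc n → ℝ} (hρ : ContDiff ℝ ∞ ρ) (i : Fin n) :
    ContDiff ℝ ∞ (unitSlope ρ i) :=
  (contDiff_fderiv_apply hρ _).mul (contDiff_inv_sqrt_one_add_gradient hρ)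

theorem continuous_graphMeanCurvature {ρ : Euc n → ℝ} (hρ : ContDiff ℝ ∞ ρ) :
    Continuous (graphMeanCurvature ρ) :=
  continuous_finsetSum _ fun i _ => (contDiff_fderiv_apply (contDiff_unitSlope hρ i) _).continuous

/-- As `∇ρ` vanishes at `0`, the normalizing factor is `1` there and its derivative is multiplied by
zero; what remains is the trace of the Hessian. -/
theorem graphMeanCurvature_zero {ρ : Euc n → ℝ} (hρ : ContDiff ℝ ∞ ρ) {κ : Fin n → ℝ}
    (h : IsPrincipal ρ κ) : graphMeanCurvature ρ 0 = ∑ i, κ i := by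
  refine Finset.sum_congr rfl fun i _ => ?_
  have h1 : HasFDerivAt (fun y => fderiv ℝ ρ y (EuclideanSpace.single i 1)) _ 0 :=
    ((contDiff_fderiv_apply hρ (EuclideanSpace.single i 1)).differentiable (by simp) 0).hasFDerivAt
  have h2 := ((contDiff_inv_sqrt_one_add_gradient hρ).differentiable (by simp) 0).hasFDerivAt
  have h3 : fderiv ℝ (unitSlope ρ i) 0 = _ := (h1.mul h2).fderiv
  have h4 : DifferentiableAt ℝ (fderiv ℝ ρ) 0 :=
    (hρ.fderiv_right (m := ∞) (by simp)).differentiable (by simp) 0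
  rw [h3, fderiv_clm_apply h4 (differentiableAt_const _)]
  simp [norm_gradient, h.1, h.2]

theorem inner_gradient_eq_sum (ρ φ : Euc n → ℝ) (y : Euc n) :
    inner ℝ (gradient ρ y) (gradient φ y) =
      ∑ i, fderiv ℝ ρ y (EuclideanSpace.single i 1) * fderiv ℝ φ y (EuclideanSpace.single i 1) := by
  rw [← (EuclideanSpace.basisFun (Fin n) ℝ).sum_inner_mul_inner]
  refine Finset.sum_congr rfl fun i _ => ?_
  rw [EuclideanSpace.basisFun_apply, inner_gradient_left, real_inner_comm, inner_gradient_left]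

/-- Integration by parts against the unit normal field of a graph. -/
theorem integral_sq_mul_inner_gradient {ρ φ : Euc n → ℝ} (hρ : ContDiff ℝ ∞ ρ)
    (hφ : ContDiff ℝ ∞ φ) (hc : HasCompactSupport φ) :
    ∫ y, φ y ^ 2 * (inner ℝ (gradient ρ y) (gradient φ y) * (√(1 + ‖gradient ρ y‖ ^ 2))⁻¹) =
      -∫ y, φ y ^ 3 / 3 * graphMeanCurvature ρ y := by
  have hc3 : HasCompactSupport fun y => φ y ^ 3 / 3 :=
    hc.comp_left (g := fun t : ℝ => t ^ 3 / 3) (by norm_num)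
  have hs3 : ContDiff ℝ ∞ fun y => φ y ^ 3 / 3 := (hφ.pow 3).div_const 3
  -- The weight `φ²` makes `φ² ∇φ` an exact gradient, that of `φ³ / 3`; the same `φ³ / 3` appears in
  -- the volume term.
  have hd : ∀ y v, fderiv ℝ (fun y => φ y ^ 3 / 3) y v = φ y ^ 2 * fderiv ℝ φ y v := by
    intro y v
    have h := ((hφ.differentiable (by simp) y).hasFDerivAt.pow 3).mul_const (3⁻¹ : ℝ)
    have h' : fderiv ℝ (fun y => φ y ^ 3 / 3) y = _ := h.fderiv
    rw [h']
    simp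
    ring
  have hint : ∀ i : Fin n, Integrable fun y =>
      unitSlope ρ i y * fderiv ℝ (fun y => φ y ^ 3 / 3) y (EuclideanSpace.single i 1) := fun i =>
    Continuous.integrable_of_hasCompactSupport
      ((contDiff_unitSlope hρ i).continuous.mul (contDiff_fderiv_apply hs3 _).continuous)
      (hc3.fderiv_apply (𝕜 := ℝ) _).mul_left
  have hint' : ∀ i : Fin n, Integrable fun y =>
      fderiv ℝ (unitSlope ρ i) y (EuclideanSpace.single i 1) * (φ y ^ 3 / 3) := fun i =>
    Continuous.integrable_of_hasCompactSupport
      ((contDiff_fderiv_apply (contDiff_unitSlope hρ i) _).continuous.mul hs3.continuous)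
      hc3.mul_left
  have hi : ∀ i : Fin n,
      ∫ y, unitSlope ρ i y * fderiv ℝ (fun y => φ y ^ 3 / 3) y (EuclideanSpace.single i 1) =
        -∫ y, fderiv ℝ (unitSlope ρ i) y (EuclideanSpace.single i 1) * (φ y ^ 3 / 3) := fun i =>
    integral_mul_fderiv_eq_neg_fderiv_mul_of_integrable (hint' i) (hint i)
      (Continuous.integrable_of_hasCompactSupport
        ((contDiff_unitSlope hρ i).continuous.mul hs3.continuous) hc3.mul_left)
      (fun y _ => (contDiff_unitSlope hρ i).differentiable (by simp) y)
      (fun y _ => hs3.differentiable (by simp) y)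
  have hsum := Finset.sum_congr rfl fun i (_ : i ∈ Finset.univ) => hi i
  rw [← integral_finsetSum _ fun i _ => hint i, Finset.sum_neg_distrib,
    ← integral_finsetSum _ fun i _ => hint' i] at hsum
  refine (integral_congr_ae (Eventually.of_forall fun y => ?_)).trans
    (hsum.trans (congrArg Neg.neg (integral_congr_ae (Eventually.of_forall fun y => ?_))))
  · rw [inner_gradient_eq_sum, Finset.sum_mul, Finset.mul_sum]
    refine Finset.sum_congr rfl fun i _ => ?_
    rw [hd, unitSlope]
    ring
  · simp only [graphMeanCurvature, Finset.mul_sum]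
    exact Finset.sum_congr rfl fun i _ => mul_comm _ _

theorem sqrt_one_add_norm_add_sq_le (g h : Euc n) (δ : ℝ) :
    √(1 + ‖g + δ • h‖ ^ 2) ≤
      √(1 + ‖g‖ ^ 2) + δ * (inner ℝ g h * (√(1 + ‖g‖ ^ 2))⁻¹) + δ ^ 2 * (‖h‖ ^ 2 / 2) := by
  have ha : √(1 + ‖g‖ ^ 2) ^ 2 = 1 + ‖g‖ ^ 2 := Real.sq_sqrt (by positivity)
  have ha1 : 1 ≤ √(1 + ‖g‖ ^ 2) := Real.one_le_sqrt.2 (by nlinarith [norm_nonneg g])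
  have hb : √(1 + ‖g + δ • h‖ ^ 2) ^ 2 = 1 + ‖g + δ • h‖ ^ 2 := Real.sq_sqrt (by positivity)
  generalize √(1 + ‖g + δ • h‖ ^ 2) = b at *
  rw [norm_add_sq_real, inner_smul_right, norm_smul, mul_pow, Real.norm_eq_abs, sq_abs] at hb
  generalize √(1 + ‖g‖ ^ 2) = a at *
  -- Concavity of the square root: its tangent at `a²` lies above it. Since `a ≥ 1`, the factor
  -- `a⁻¹` in the quadratic term can be dropped afterwards.
  have h1 : b ≤ a + (b ^ 2 - a ^ 2) / (2 * a) := by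
    rw [← sub_le_iff_le_add', le_div_iff₀ (by positivity)]
    nlinarith [sq_nonneg (b - a)]
  have h2 : (b ^ 2 - a ^ 2) / (2 * a) = δ * (inner ℝ g h * a⁻¹) + δ ^ 2 * (‖h‖ ^ 2 / 2) * a⁻¹ := by
    rw [hb, ha]
    field_simp
    ring
  have h3 : δ ^ 2 * (‖h‖ ^ 2 / 2) * a⁻¹ ≤ δ ^ 2 * (‖h‖ ^ 2 / 2) :=
    mul_le_of_le_one_right (by positivity) (inv_le_one_of_one_le₀ ha1)
  linarith

theorem integrable_area_integrand {ρ φ : Euc n → ℝ} (hρ : ContDiff ℝ ∞ ρ)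
    (hφ : ContDiff ℝ ∞ φ) (hc : HasCompactSupport φ) (δ : ℝ) :
    Integrable fun y => φ y ^ 2 * √(1 + ‖gradient ρ y + δ • gradient φ y‖ ^ 2) := by
  have h1 := hρ.gradient_top.continuous
  have h2 := hφ.gradient_top.continuous
  have h3 := hφ.continuous
  exact Continuous.integrable_of_hasCompactSupport (by fun_prop)
    (hc.comp_left (g := fun t : ℝ => t ^ 2) (by norm_num)).mul_right

theorem integrable_pow_of_hasCompactSupport {φ : Euc n → ℝ}
    (hφ : Continuous φ) (hc : HasCompactSupport φ) {k : ℕ} (hk : k ≠ 0) :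
    Integrable fun y => φ y ^ k :=
  (hφ.pow k).integrable_of_hasCompactSupport
    (hc.comp_left (g := fun t : ℝ => t ^ k) (by simp [hk]))

/-- Where the mean curvature of a graph is larger than `1`, moving the graph upwards decreases its
area by more than the volume which is swept out. -/
theorem eventually_integral_area_lt {ρ φ : Euc n → ℝ} (hρ : ContDiff ℝ ∞ ρ)
    (hφ : ContDiff ℝ ∞ φ) (hc : HasCompactSupport φ) (h0 : ∀ y, 0 ≤ φ y) (hpos : 0 < φ 0)
    (hH : ∀ y, φ y ≠ 0 → 1 < graphMeanCurvature ρ y) :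
    ∀ᶠ δ : ℝ in 𝓝[>] 0,
      ∫ y, (φ y ^ 2 * √(1 + ‖gradient ρ y + δ • gradient φ y‖ ^ 2) + δ * (φ y ^ 3 / 3)) <
        ∫ y, φ y ^ 2 * √(1 + ‖gradient ρ y‖ ^ 2) := by
  have hρc := hρ.gradient_top.continuous
  have hφg := hφ.gradient_top.continuous
  have hφc := hφ.continuous
  have hHc := continuous_graphMeanCurvature hρ
  have hac := (contDiff_inv_sqrt_one_add_gradient hρ).continuous
  have hc2 : HasCompactSupport fun y => φ y ^ 2 :=
    hc.comp_left (g := fun t : ℝ => t ^ 2) (by norm_num)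
  have hc3 : HasCompactSupport fun y => φ y ^ 3 / 3 :=
    hc.comp_left (g := fun t : ℝ => t ^ 3 / 3) (by norm_num)
  have i0 : Integrable fun y => φ y ^ 2 * √(1 + ‖gradient ρ y‖ ^ 2) :=
    Continuous.integrable_of_hasCompactSupport (by fun_prop) hc2.mul_right
  have i1 : Integrable fun y =>
      φ y ^ 2 * (inner ℝ (gradient ρ y) (gradient φ y) * (√(1 + ‖gradient ρ y‖ ^ 2))⁻¹) :=
    Continuous.integrable_of_hasCompactSupport (by fun_prop) hc2.mul_right
  have i2 : Integrable fun y => φ y ^ 3 / 3 :=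
    Continuous.integrable_of_hasCompactSupport (by fun_prop) hc3
  have i3 : Integrable fun y => φ y ^ 2 * (‖gradient φ y‖ ^ 2 / 2) :=
    Continuous.integrable_of_hasCompactSupport (by fun_prop) hc2.mul_right
  have i4 : Integrable fun y => φ y ^ 3 / 3 * graphMeanCurvature ρ y :=
    Continuous.integrable_of_hasCompactSupport (by fun_prop) hc3.mul_right
  set I₀ := ∫ y, φ y ^ 2 * √(1 + ‖gradient ρ y‖ ^ 2)
  set R := ∫ y, φ y ^ 2 * (‖gradient φ y‖ ^ 2 / 2)
  have hR : 0 ≤ R := integral_nonneg fun y => by positivity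
  -- `E` is the rate, to first order in `δ`, at which area lost exceeds volume gained; `R` controls
  -- the second-order error.
  set E := ∫ y, φ y ^ 3 / 3 * (graphMeanCurvature ρ y - 1)
  have hE : 0 < E := by
    have hnn : ∀ y, 0 ≤ φ y ^ 3 / 3 * (graphMeanCurvature ρ y - 1) := by
      intro y
      by_cases hy : φ y = 0
      · simp [hy]
      · have := hH y hy
        have := h0 y
        exact mul_nonneg (by positivity) (by linarith)
    refine Continuous.integral_pos_of_hasCompactSupport_nonneg_nonzero (x := 0) (by fun_prop)
      hc3.mul_right hnn ?_
    have := hH 0 hpos.ne'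
    exact (mul_pos (by positivity) (by linarith)).ne'
  have hEeq : E = -(∫ y, φ y ^ 2 *
      (inner ℝ (gradient ρ y) (gradient φ y) * (√(1 + ‖gradient ρ y‖ ^ 2))⁻¹)) -
        ∫ y, φ y ^ 3 / 3 := by
    rw [integral_sq_mul_inner_gradient hρ hφ hc, neg_neg, ← integral_sub i4 i2]
    exact integral_congr_ae (Eventually.of_forall fun y => by simp only; ring)
  -- Below this threshold `δ² R < δ E`; the `+ 1` guards against `R = 0`.
  have hlt : ∀ᶠ δ : ℝ in 𝓝[>] 0, δ < E / (R + 1) :=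
    (eventually_lt_nhds (by positivity)).filter_mono nhdsWithin_le_nhds
  filter_upwards [hlt, self_mem_nhdsWithin] with δ hδ hδ0
  have hδ0 : 0 < δ := hδ0
  rw [lt_div_iff₀ (by positivity)] at hδ
  have j1 : Integrable fun y => φ y ^ 2 * √(1 + ‖gradient ρ y‖ ^ 2) + δ * (φ y ^ 2 *
      (inner ℝ (gradient ρ y) (gradient φ y) * (√(1 + ‖gradient ρ y‖ ^ 2))⁻¹)) :=
    i0.add (i1.const_mul δ)
  have j2 : Integrable fun y => (φ y ^ 2 * √(1 + ‖gradient ρ y‖ ^ 2) + δ * (φ y ^ 2 *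
      (inner ℝ (gradient ρ y) (gradient φ y) * (√(1 + ‖gradient ρ y‖ ^ 2))⁻¹))) +
        δ * (φ y ^ 3 / 3) :=
    j1.add (i2.const_mul δ)
  have hle : ∫ y, (φ y ^ 2 * √(1 + ‖gradient ρ y + δ • gradient φ y‖ ^ 2) + δ * (φ y ^ 3 / 3)) ≤
      ∫ y, ((φ y ^ 2 * √(1 + ‖gradient ρ y‖ ^ 2) + δ * (φ y ^ 2 *
        (inner ℝ (gradient ρ y) (gradient φ y) * (√(1 + ‖gradient ρ y‖ ^ 2))⁻¹))) +
          δ * (φ y ^ 3 / 3) + δ ^ 2 * (φ y ^ 2 * (‖gradient φ y‖ ^ 2 / 2))) := by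
    refine integral_mono ((integrable_area_integrand hρ hφ hc δ).add (i2.const_mul δ))
      (j2.add (i3.const_mul _)) fun y => ?_
    have := mul_le_mul_of_nonneg_left
      (sqrt_one_add_norm_add_sq_le (gradient ρ y) (gradient φ y) δ) (sq_nonneg (φ y))
    simp only
    linarith
  rw [integral_add j2 (i3.const_mul _), integral_add j1 (i2.const_mul δ), integral_add i0 (i1.const_mul δ),
    integral_const_mul, integral_const_mul, integral_const_mul] at hle
  refine hle.trans_lt ?_
  have : δ * (δ * (R + 1)) < δ * E := mul_lt_mul_of_pos_left hδ hδ0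
  nlinarith

end FirstVariation

/-! ### Smooth test functions for the trace constant -/

section TestFunctions

variable {n d : ℕ}

theorem continuous_gradient {u : Euc d → ℝ} (hu : ContDiff ℝ 1 u) : Continuous (gradient u) :=
  (InnerProductSpace.toDual ℝ (Euc d)).symm.continuous.comp (hu.continuous_fderiv one_ne_zero)

theorem hasCompactSupport_gradient {u : Euc d → ℝ} (hc : HasCompactSupport u) :
    HasCompactSupport (gradient u) :=
  (hc.fderiv (𝕜 := ℝ)).comp_left (g := (InnerProductSpace.toDual ℝ (Euc d)).symm) (map_zero _)

theorem integrable_gradient {u : Euc d → ℝ} (hu : ContDiff ℝ 1 u) (hc : HasCompactSupport u) :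
    Integrable (gradient u) :=
  (continuous_gradient hu).integrable_of_hasCompactSupport (hasCompactSupport_gradient hc)

theorem memW11_of_contDiff {Ω : Set (Euc d)} {u : Euc d → ℝ} (hu : ContDiff ℝ 1 u)
    (hc : HasCompactSupport u) : MemW11 Ω u (gradient u) := by
  refine ⟨(hu.continuous.integrable_of_hasCompactSupport hc).integrableOn,
    (integrable_gradient hu hc).integrableOn, ?_⟩
  rintro φ ⟨hφ, hφc, hφΩ⟩ v
  have hd : ∀ f : Euc d → ℝ, ContDiff ℝ 1 f → Continuous fun x => fderiv ℝ f x v := fun f hf =>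
    (hf.continuous_fderiv one_ne_zero).clm_apply continuous_const
  have hφ1 : ContDiff ℝ 1 φ := hφ.of_le (by simp)
  have hout : ∀ x, x ∉ Ω → x ∉ tsupport φ := fun x hx h => hx (hφΩ h)
  rw [setIntegral_eq_integral_of_forall_compl_eq_zero,
    setIntegral_eq_integral_of_forall_compl_eq_zero]
  · simp only [inner_gradient_left]
    exact integral_mul_fderiv_eq_neg_fderiv_mul_of_integrable
      (((hd u hu).mul hφ.continuous).integrable_of_hasCompactSupport hφc.mul_left)
      ((hu.continuous.mul (hd φ hφ1)).integrable_of_hasCompactSupport hc.mul_right)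
      ((hu.continuous.mul hφ.continuous).integrable_of_hasCompactSupport hc.mul_right)
      (fun x _ => hu.differentiable one_ne_zero x) (fun x _ => hφ.differentiable (by simp) x)
  · intro x hx
    rw [image_eq_zero_of_notMem_tsupport (hout x hx), mul_zero]
  · intro x hx
    rw [fderiv_of_notMem_tsupport ℝ (hout x hx), zero_apply, mul_zero]

theorem integral_fderiv_eq_zero {u : Euc d → ℝ} (hu : ContDiff ℝ 1 u) (hc : HasCompactSupport u)
    (v : Euc d) : ∫ x, fderiv ℝ u x v = 0 := by
  have hd : Continuous fun x => fderiv ℝ u x v :=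
    (hu.continuous_fderiv one_ne_zero).clm_apply continuous_const
  have h := integral_mul_fderiv_eq_neg_fderiv_mul_of_integrable (μ := volume)
    (f := fun _ : Euc d => (1 : ℝ)) (g := u) (v := v) (by simp)
    (by simpa using hd.integrable_of_hasCompactSupport (hc.fderiv_apply (𝕜 := ℝ) v))
    (by simpa using hu.continuous.integrable_of_hasCompactSupport hc)
    (fun x _ => differentiableAt_const _) (fun x _ => hu.differentiable one_ne_zero x)
  simpa using h

/-- Gradients of test functions have mean zero, and this passes to `W^{1,1}` limits. It serves to
show that a function is not in `W_0^{1,1}` without any trace theory. -/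
theorem MemW11Zero.integral_inner_eq_zero {Ω : Set (Euc d)} {u : Euc d → ℝ} {G : Euc d → Euc d}
    (h : MemW11Zero Ω u G) (v : Euc d) : ∫ x in Ω, inner ℝ (G x) v = 0 := by
  rw [← norm_le_zero_iff]
  refine le_of_forall_pos_le_add fun η hη => ?_
  obtain ⟨φ, ⟨hφ, hφc, hφΩ⟩, hlt⟩ := h.2 (ENNReal.ofReal (η / (‖v‖ + 1)))
    (ENNReal.ofReal_pos.2 (by positivity))
  have hφ1 : ContDiff ℝ 1 φ := hφ.of_le (by simp)
  have hG := h.1.2.1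
  have hφi : IntegrableOn (gradient φ) Ω := (integrable_gradient hφ1 hφc).integrableOn
  have h0 : ∫ x in Ω, inner ℝ (gradient φ x) v = 0 := by
    simp only [inner_gradient_left]
    rw [setIntegral_eq_integral_of_forall_compl_eq_zero, integral_fderiv_eq_zero hφ1 hφc]
    intro x hx
    rw [fderiv_of_notMem_tsupport ℝ fun hx' => hx (hφΩ hx'), zero_apply]
  have h1 : ∫ x in Ω, inner ℝ (G x) v = ∫ x in Ω, inner ℝ (G x - gradient φ x) v := by
    simp only [inner_sub_left]
    rw [integral_sub (hG.inner_const v) (hφi.inner_const v), h0, sub_zero]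
  have h2 : ∫ x in Ω, ‖G x - gradient φ x‖ ≤ η / (‖v‖ + 1) := by
    rw [integral_norm_eq_lintegral_enorm (f := fun x => G x - gradient φ x)
      (hG.sub hφi).aestronglyMeasurable]
    refine ENNReal.toReal_le_of_le_ofReal (by positivity) (le_trans ?_ hlt.le)
    exact le_self_add
  rw [h1, zero_add]
  calc ‖∫ x in Ω, inner ℝ (G x - gradient φ x) v‖
      ≤ ∫ x in Ω, ‖G x - gradient φ x‖ * ‖v‖ :=
        norm_integral_le_of_norm_le ((hG.sub hφi).norm.mul_const _)
          (Eventually.of_forall fun x => norm_inner_le_norm _ _)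
    _ = (∫ x in Ω, ‖G x - gradient φ x‖) * ‖v‖ := integral_mul_const _ _
    _ ≤ η / (‖v‖ + 1) * (‖v‖ + 1) := by gcongr; linarith
    _ = η := by field_simp

theorem isTrace_of_continuous {Ω : Set (Euc (n + 1))} {u : Euc (n + 1) → ℝ}
    (hu : Continuous u) : IsTrace Ω u u := by
  refine Eventually.of_forall fun x => ?_
  rw [Metric.tendsto_nhdsWithin_nhds]
  intro ε hε
  obtain ⟨δ, hδ, hux⟩ := Metric.continuous_iff.1 hu x (ε / 2) (by positivity)
  refine ⟨δ, hδ, fun r hr0 hr => ?_⟩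
  have hrδ : r < δ := by
    simpa [abs_of_pos (show (0 : ℝ) < r from hr0)] using hr
  have hfin : volume (Ω ∩ Metric.ball x r) < ⊤ :=
    (measure_mono Set.inter_subset_right).trans_lt measure_ball_lt_top
  have hbound : ‖∫ z in Ω ∩ Metric.ball x r, |u z - u x|‖ ≤
      ε / 2 * volume.real (Ω ∩ Metric.ball x r) := by
    refine norm_setIntegral_le_of_norm_le_const hfin fun z hz => ?_
    rw [norm_abs_eq_norm, ← dist_eq_norm]
    exact (hux z ((Metric.mem_ball.1 hz.2).trans hrδ)).le
  rw [dist_zero_right, setAverage_eq, norm_smul, norm_inv, Real.norm_of_nonneg measureReal_nonneg]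
  refine lt_of_le_of_lt ?_ (half_lt_self hε)
  -- If the intersection is null, the average is `0` by the convention `0⁻¹ = 0`.
  rcases (measureReal_nonneg (μ := volume) (s := Ω ∩ Metric.ball x r)).eq_or_lt with h | h
  · rw [← h]; simp; positivity
  · rw [inv_mul_le_iff₀ h, mul_comm]
    exact hbound

/-- A `C¹` test function for `λ_1(Ω) < 1`. -/
theorem lambdaOne_lt_one_of_contDiff {Ω : Set (Euc (n + 1))} {u : Euc (n + 1) → ℝ}
    (hu : ContDiff ℝ 1 u) (hc : HasCompactSupport u) {v : Euc (n + 1)}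
    (hv : ∫ x in Ω, fderiv ℝ u x v ≠ 0)
    (hlt : (∫⁻ x in Ω, ‖fderiv ℝ u x‖ₑ) + ∫⁻ x in Ω, ‖u x‖ₑ <
      ∫⁻ x in frontier Ω, ‖u x‖ₑ ∂(μHE[n] : Measure (Euc (n + 1)))) : lambdaOne Ω < 1 := by
  have hW0 : ¬ MemW11Zero Ω u (gradient u) := fun h => hv <| by
    simpa only [inner_gradient_left] using h.integral_inner_eq_zero v
  refine lt_of_le_of_lt (iInf_le_of_le u <| iInf_le_of_le (gradient u) <| iInf_le_of_le u <|
    iInf_le_of_le (memW11_of_contDiff hu hc) <| iInf_le_of_le hW0 <|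
      iInf_le_of_le (isTrace_of_continuous hu.continuous) le_rfl) ?_
  have hg : ∀ x, ‖gradient u x‖ₑ = ‖fderiv ℝ u x‖ₑ := fun x => by simp [gradient]
  refine ENNReal.div_lt_of_lt_mul' ?_
  rw [mul_one]
  simpa only [normW11, hg] using hlt

/-- Squaring removes the corner of the positive part. The test function is then `C¹`, with classical
gradient and boundary values. -/
theorem hasDerivAt_max_zero_sq (s : ℝ) :
    HasDerivAt (fun s : ℝ => max 0 s ^ 2) (2 * max 0 s) s := by
  rcases lt_trichotomy s 0 with h | rfl | h
  · rw [max_eq_left h.le, mul_zero]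
    refine (hasDerivAt_const s (0 : ℝ)).congr_of_eventuallyEq ?_
    filter_upwards [eventually_lt_nhds h] with t ht
    simp [max_eq_left ht.le]
  · rw [max_self, mul_zero, hasDerivAt_iff_isLittleO_nhds_zero]
    have : (fun h : ℝ => max 0 h ^ 2) =O[𝓝 0] fun h : ℝ => h ^ 2 := by
      refine IsBigO.of_bound 1 (Eventually.of_forall fun h => ?_)
      rw [one_mul, Real.norm_eq_abs, Real.norm_eq_abs, abs_pow, abs_pow]
      gcongr 1
      rcases le_total 0 h with h' | h' <;> simp [h']
    simpa using this.trans_isLittleO (isLittleO_pow_id one_lt_two)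
  · rw [max_eq_right h.le]
    have h2 := hasDerivAt_pow 2 s
    simp only [Nat.cast_ofNat, Nat.add_one_sub_one, pow_one] at h2
    refine h2.congr_of_eventuallyEq ?_
    filter_upwards [eventually_gt_nhds h] with t ht
    rw [max_eq_right ht.le]

theorem contDiff_max_zero_sq : ContDiff ℝ 1 fun s : ℝ => max 0 s ^ 2 := by
  rw [contDiff_one_iff_deriv]
  refine ⟨fun s => (hasDerivAt_max_zero_sq s).differentiableAt, ?_⟩
  rw [funext fun s => (hasDerivAt_max_zero_sq s).deriv]
  fun_prop

/-- This is the integral over the vertical line above `y`, with `a = φ(y)`, `b = ρ(y)` and `C` the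
slope factor. With `p = a - (t - b) / δ`, the integrand is the derivative of `-C p² - (δ / 3) p³`
while `p` falls from `a` to `0`, and zero afterwards. -/
theorem lintegral_fiber_le {a C δ : ℝ} (ha : 0 ≤ a) (hC : 0 ≤ C) (hδ : 0 < δ) (b : ℝ) :
    ∫⁻ t in Set.Ioi b, ENNReal.ofReal
      (2 * max 0 (a - (t - b) / δ) * (C / δ) + max 0 (a - (t - b) / δ) ^ 2) ≤
        ENNReal.ofReal (a ^ 2 * C + δ * (a ^ 3 / 3)) := by
  have hle : b ≤ b + δ * a := le_add_of_nonneg_right (by positivity)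
  have hcont : Continuous fun t : ℝ =>
      2 * max 0 (a - (t - b) / δ) * (C / δ) + max 0 (a - (t - b) / δ) ^ 2 := by fun_prop
  have hnn : ∀ t : ℝ,
      0 ≤ 2 * max 0 (a - (t - b) / δ) * (C / δ) + max 0 (a - (t - b) / δ) ^ 2 := fun t => by
    positivity
  have hder : ∀ t : ℝ, HasDerivAt (fun t =>
      -(C * (a - (t - b) / δ) ^ 2) - δ / 3 * (a - (t - b) / δ) ^ 3)
      (2 * (a - (t - b) / δ) * (C / δ) + (a - (t - b) / δ) ^ 2) t := by
    intro t
    have h1 : HasDerivAt (fun t => a - (t - b) / δ) (-(1 / δ)) t :=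
      (((hasDerivAt_id t).sub_const b).div_const δ).const_sub a
    refine ((((h1.pow 2).const_mul C).neg.sub ((h1.pow 3).const_mul (δ / 3)))).congr_deriv ?_
    simp only [Nat.cast_ofNat, Nat.add_one_sub_one, pow_one]
    field_simp
    ring
  have hval : ∫ t in b..(b + δ * a),
      (2 * max 0 (a - (t - b) / δ) * (C / δ) + max 0 (a - (t - b) / δ) ^ 2) =
        a ^ 2 * C + δ * (a ^ 3 / 3) := by
    have : Set.EqOn
        (fun t => 2 * max 0 (a - (t - b) / δ) * (C / δ) + max 0 (a - (t - b) / δ) ^ 2)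
        (fun t => 2 * (a - (t - b) / δ) * (C / δ) + (a - (t - b) / δ) ^ 2)
        (Set.uIcc b (b + δ * a)) := by
      intro t ht
      rw [Set.uIcc_of_le hle] at ht
      have : (t - b) / δ ≤ a := by
        rw [div_le_iff₀ hδ]
        linarith [ht.2]
      simp only [max_eq_right (sub_nonneg.2 this)]
    rw [intervalIntegral.integral_congr this,
      intervalIntegral.integral_eq_sub_of_hasDerivAt (fun t _ => hder t)
        (Continuous.intervalIntegrable (by fun_prop) _ _)]
    field_simp
    ring
  rw [← hval, intervalIntegral.integral_of_le hle, ofReal_integral_eq_lintegral_ofReal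
    (hcont.integrableOn_Ioc) (Eventually.of_forall hnn), ← lintegral_indicator measurableSet_Ioi,
    ← lintegral_indicator measurableSet_Ioc]
  refine lintegral_mono fun t => ?_
  by_cases ht : t ∈ Set.Ioc b (b + δ * a)
  · rw [Set.indicator_of_mem ht]
    exact Set.indicator_le_self _ _ _
  · refine le_trans (le_of_eq ?_) zero_le
    by_cases htb : t ∈ Set.Ioi b
    · have h1 : b + δ * a < t := by
        by_contra h
        exact ht ⟨htb, not_lt.1 h⟩
      have h2 : a ≤ (t - b) / δ := by
        rw [le_div_iff₀ hδ]
        linarith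
      rw [Set.indicator_of_mem htb, max_eq_left (sub_nonpos.2 h2)]
      simp
    · exact Set.indicator_of_notMem htb _

/-- Isometries preserve Hausdorff measure, which in top dimension is the volume on either side. -/
theorem measurePreserving_isometryEquiv {E F : Type*} [NormedAddCommGroup E]
    [InnerProductSpace ℝ E] [MeasurableSpace E] [BorelSpace E] [FiniteDimensional ℝ E]
    [NormedAddCommGroup F] [InnerProductSpace ℝ F] [MeasurableSpace F] [BorelSpace F]
    [FiniteDimensional ℝ F] (e : E ≃ᵃⁱ[ℝ] F) : MeasurePreserving e := by
  have h := e.toIsometryEquiv.measurePreserving_euclideanHausdorffMeasure (Module.finrank ℝ E)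
  have h2 : Module.finrank ℝ E = Module.finrank ℝ F := e.linearIsometryEquiv.toLinearEquiv.finrank_eq
  rw [InnerProductSpace.euclideanHausdorffMeasure_eq_volume, h2,
    InnerProductSpace.euclideanHausdorffMeasure_eq_volume] at h
  exact h

end TestFunctions

/-! ### Test functions concentrated near a graph -/

section GraphTestFunction

variable {n : ℕ}

/-- The function `φ(y) - (t - ρ(y)) / δ`: it equals `φ` on the graph of `ρ` and vanishes on the
graph of `ρ + δ φ`. -/
def graphLayer (ρ φ : Euc n → ℝ) (δ : ℝ) (w : EucProd n) : ℝ :=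
  φ w.fst - (w.snd - ρ w.fst) / δ

theorem contDiff_graphLayer {ρ φ : Euc n → ℝ} (hρ : ContDiff ℝ ∞ ρ) (hφ : ContDiff ℝ ∞ φ)
    (δ : ℝ) : ContDiff ℝ ∞ (graphLayer ρ φ δ) := by
  have h1 : ContDiff ℝ ∞ fun w : EucProd n => w.fst := (WithLp.fstL 2 ℝ (Euc n) ℝ).contDiff
  have h2 : ContDiff ℝ ∞ fun w : EucProd n => w.snd := (WithLp.sndL 2 ℝ (Euc n) ℝ).contDiff
  exact (hφ.comp h1).sub ((h2.sub (hρ.comp h1)).div_const δ)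

theorem fderiv_layer_apply {E : Type*} [NormedAddCommGroup E] [NormedSpace ℝ E]
    (A : E →L[ℝ] Euc n) (B : E →L[ℝ] ℝ) {ρ φ : Euc n → ℝ} (hρ : ContDiff ℝ ∞ ρ)
    (hφ : ContDiff ℝ ∞ φ) {δ : ℝ} (hδ : 0 < δ) (w v : E) :
    fderiv ℝ (fun w => φ (A w) - (B w - ρ (A w)) / δ) w v =
      (inner ℝ (gradient ρ (A w) + δ • gradient φ (A w)) (A v) - B v) / δ := by
  have h3 : HasFDerivAt (fun w => ρ (A w)) _ w :=
    (hρ.differentiable (by simp) (A w)).hasFDerivAt.comp w A.hasFDerivAt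
  have h4 : HasFDerivAt (fun w => φ (A w)) _ w :=
    (hφ.differentiable (by simp) (A w)).hasFDerivAt.comp w A.hasFDerivAt
  have h5 : HasFDerivAt (fun w => φ (A w) - δ⁻¹ * (B w - ρ (A w))) _ w :=
    h4.sub ((B.hasFDerivAt.sub h3).const_mul δ⁻¹)
  simp only [div_eq_inv_mul]
  rw [h5.fderiv, inner_add_left, real_inner_smul_left, inner_gradient_left,
    inner_gradient_left]
  change fderiv ℝ φ (A w) (A v) - δ⁻¹ * (B v - fderiv ℝ ρ (A w) (A v)) = _
  field_simp
  ring

theorem fderiv_graphLayer_apply {ρ φ : Euc n → ℝ} (hρ : ContDiff ℝ ∞ ρ) (hφ : ContDiff ℝ ∞ φ)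
    {δ : ℝ} (hδ : 0 < δ) (w v : EucProd n) :
    fderiv ℝ (graphLayer ρ φ δ) w v =
      (inner ℝ (gradient ρ w.fst + δ • gradient φ w.fst) v.fst - v.snd) / δ :=
  fderiv_layer_apply (WithLp.fstL 2 ℝ (Euc n) ℝ) (WithLp.sndL 2 ℝ (Euc n) ℝ) hρ hφ hδ w v

/-- The derivative is pairing with `(a, -1) / δ`, where `a = ∇ρ + δ∇φ`; the bound is Cauchy–Schwarz.
-/
theorem norm_fderiv_graphLayer_le {ρ φ : Euc n → ℝ} (hρ : ContDiff ℝ ∞ ρ) (hφ : ContDiff ℝ ∞ φ)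
    {δ : ℝ} (hδ : 0 < δ) (w : EucProd n) :
    ‖fderiv ℝ (graphLayer ρ φ δ) w‖ ≤
      √(1 + ‖gradient ρ w.fst + δ • gradient φ w.fst‖ ^ 2) / δ := by
  refine ContinuousLinearMap.opNorm_le_bound _ (by positivity) fun v => ?_
  rw [fderiv_graphLayer_apply hρ hφ hδ, norm_div, Real.norm_of_nonneg hδ.le, div_mul_eq_mul_div]
  gcongr
  generalize gradient ρ w.fst + δ • gradient φ w.fst = a
  refine abs_le_of_sq_le_sq ?_ (by positivity)
  have h1 := WithLp.prod_norm_sq_eq_of_L2 v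
  have h2 : inner ℝ a v.fst ^ 2 ≤ (‖a‖ * ‖v.fst‖) ^ 2 :=
    sq_le_sq' (neg_le_of_abs_le (abs_real_inner_le_norm _ _)) (real_inner_le_norm _ _)
  have h3 : |inner ℝ a v.fst| ≤ ‖a‖ * ‖v.fst‖ := abs_real_inner_le_norm _ _
  rw [mul_pow, Real.sq_sqrt (by positivity), h1, Real.norm_eq_abs, sq_abs]
  have h4 : -(2 * inner ℝ a v.fst * v.snd) ≤ 2 * (‖a‖ * ‖v.fst‖) * |v.snd| := by
    calc -(2 * inner ℝ a v.fst * v.snd) ≤ |2 * inner ℝ a v.fst * v.snd| := neg_le_abs _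
      _ = 2 * |inner ℝ a v.fst| * |v.snd| := by rw [abs_mul, abs_mul, abs_two]
      _ ≤ _ := by gcongr
  nlinarith [sq_nonneg (‖a‖ * |v.snd| - ‖v.fst‖), sq_abs v.snd]

theorem norm_eucProd_le (w : EucProd n) : ‖w‖ ≤ ‖w.fst‖ + |w.snd| := by
  refine le_of_sq_le_sq ?_ (by positivity)
  rw [WithLp.prod_norm_sq_eq_of_L2, Real.norm_eq_abs]
  nlinarith [mul_nonneg (norm_nonneg w.fst) (abs_nonneg w.snd)]

/-- The integral of the gradient and the values of the squared positive part of `graphLayer`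
above the graph of `ρ`. -/
theorem lintegral_graphLayer_le {ρ φ : Euc n → ℝ} (hρ : ContDiff ℝ ∞ ρ) (hφ : ContDiff ℝ ∞ φ)
    (hc : HasCompactSupport φ) (h0 : ∀ y, 0 ≤ φ y) {δ : ℝ} (hδ : 0 < δ) :
    ∫⁻ w in {w : EucProd n | ρ w.fst < w.snd}, ENNReal.ofReal
      (2 * max 0 (graphLayer ρ φ δ w) *
          (√(1 + ‖gradient ρ w.fst + δ • gradient φ w.fst‖ ^ 2) / δ) +
        max 0 (graphLayer ρ φ δ w) ^ 2) ≤
      ENNReal.ofReal (∫ y, (φ y ^ 2 * √(1 + ‖gradient ρ y + δ • gradient φ y‖ ^ 2) +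
        δ * (φ y ^ 3 / 3))) := by
  have h1 : Continuous fun w : EucProd n => w.fst := by fun_prop
  have h2 : Continuous fun w : EucProd n => w.snd := by fun_prop
  have hp := (contDiff_graphLayer hρ hφ δ).continuous
  have hg1 := hρ.gradient_top.continuous.comp h1
  have hg2 := hφ.gradient_top.continuous.comp h1
  have hS : MeasurableSet {w : EucProd n | ρ w.fst < w.snd} :=
    (isOpen_lt (hρ.continuous.comp h1) h2).measurableSet
  set H : EucProd n → ℝ≥0∞ := fun w => ENNReal.ofReal
      (2 * max 0 (graphLayer ρ φ δ w) *
          (√(1 + ‖gradient ρ w.fst + δ • gradient φ w.fst‖ ^ 2) / δ) +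
        max 0 (graphLayer ρ φ δ w) ^ 2)
  have hHm : Measurable H := by
    have : Continuous fun w : EucProd n => 2 * max 0 (graphLayer ρ φ δ w) *
          (√(1 + ‖gradient ρ w.fst + δ • gradient φ w.fst‖ ^ 2) / δ) +
        max 0 (graphLayer ρ φ δ w) ^ 2 := by
      simp only [Function.comp_def] at hg1 hg2
      fun_prop
    exact this.measurable.ennreal_ofReal
  have hint : Integrable fun y => φ y ^ 2 * √(1 + ‖gradient ρ y + δ • gradient φ y‖ ^ 2) +
      δ * (φ y ^ 3 / 3) :=
    (integrable_area_integrand hρ hφ hc δ).add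
      (((integrable_pow_of_hasCompactSupport hφ.continuous hc three_ne_zero).div_const 3).const_mul
        δ)
  -- Tonelli reduces the claim to vertical lines, on each of which the slope factor is constant.
  rw [← lintegral_indicator hS,
    ← (WithLp.volume_preserving_toLp (Euc n) ℝ).lintegral_comp (hHm.indicator hS),
    Measure.volume_eq_prod, lintegral_prod
      (fun a : Euc n × ℝ => Set.indicator {w : EucProd n | ρ w.fst < w.snd} H (WithLp.toLp 2 a))
      ((hHm.indicator hS).comp (WithLp.measurable_toLp 2 _)).aemeasurable,
    ofReal_integral_eq_lintegral_ofReal hint (Eventually.of_forall fun y => by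
      have := h0 y
      positivity)]
  refine lintegral_mono fun y => le_trans (le_of_eq ?_) (lintegral_fiber_le (h0 y)
    (Real.sqrt_nonneg (1 + ‖gradient ρ y + δ • gradient φ y‖ ^ 2)) hδ (ρ y))
  rw [← lintegral_indicator measurableSet_Ioi]
  rfl

variable {Ω : Set (Euc (n + 1))} {x : Euc (n + 1)} {Φ : Euc (n + 1) ≃ᵃⁱ[ℝ] EucProd n}
  {ρ φ : Euc n → ℝ} {r s δ : ℝ}

theorem affineIsometryEquiv_eq_linear_sub (h : Φ x = 0) (z : Euc (n + 1)) :
    Φ z = Φ.linearIsometryEquiv (z - x) := by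
  have := Φ.map_vsub z x
  simp only [h, vsub_eq_sub, sub_zero] at this
  exact this.symm

theorem dist_eq_norm_affineIsometryEquiv (h : Φ x = 0) (z : Euc (n + 1)) :
    dist z x = ‖Φ z‖ := by
  rw [← Φ.dist_map, h, dist_zero_right]

theorem abs_le_of_norm_fderiv_le (hρ : ContDiff ℝ ∞ ρ) (hρ0 : ρ 0 = 0)
    (hslope : ∀ y ∈ Metric.ball 0 s, ‖fderiv ℝ ρ y‖ ≤ 1 / 2) {y : Euc n} (hy : ‖y‖ < s) :
    |ρ y| < s := by
  have hs : 0 < s := (norm_nonneg y).trans_lt hy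
  have h := (convex_ball (0 : Euc n) s).norm_image_sub_le_of_norm_fderiv_le
    (fun z _ => hρ.differentiable (by simp) z) hslope (Metric.mem_ball_self hs)
    (mem_ball_zero_iff.2 hy)
  rw [hρ0, sub_zero, sub_zero, Real.norm_eq_abs] at h
  linarith

/-- If a test layer `φ` above a boundary graph decreases area plus volume, then `λ_1(Ω) < 1`. -/
theorem lambdaOne_lt_one_of_isLocalGraph (hΩ : IsOpen Ω) (hg : IsLocalGraph Ω x Φ ρ r)
    (hρ0 : ρ 0 = 0) (hφ : ContDiff ℝ ∞ φ) (hc : HasCompactSupport φ) (h0 : ∀ y, 0 ≤ φ y)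
    (h1 : ∀ y, φ y ≤ 1) (hpos : 0 < φ 0) (hsr : 6 * s ≤ r)
    (hsupp : ∀ y, φ y ≠ 0 → ‖y‖ < s)
    (hslope : ∀ y ∈ Metric.ball 0 s, ‖fderiv ℝ ρ y‖ ≤ 1 / 2) (hδ : 0 < δ) (hδs : δ ≤ s)
    (hlt : ∫ y, (φ y ^ 2 * √(1 + ‖gradient ρ y + δ • gradient φ y‖ ^ 2) + δ * (φ y ^ 3 / 3)) <
        ∫ y, φ y ^ 2 * √(1 + ‖gradient ρ y‖ ^ 2)) : lambdaOne Ω < 1 := by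
  obtain ⟨hx, hr, hρ, hloc⟩ := hg
  have hΦ := affineIsometryEquiv_eq_linear_sub hx
  have hΦc : ContDiff ℝ 1 Φ := by
    rw [funext hΦ]
    exact Φ.linearIsometryEquiv.contDiff.comp (contDiff_id.sub contDiff_const)
  have hΦd : ∀ z, HasFDerivAt Φ (Φ.linearIsometryEquiv.toContinuousLinearEquiv :
      Euc (n + 1) →L[ℝ] EucProd n) z := by
    intro z
    rw [funext hΦ]
    exact (Φ.linearIsometryEquiv.toContinuousLinearEquiv : Euc (n + 1) →L[ℝ] EucProd n).hasFDerivAt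
      |>.comp z ((hasFDerivAt_id z).sub_const x)
  let p : EucProd n → ℝ := graphLayer ρ φ δ
  have hpc : ContDiff ℝ ∞ p := contDiff_graphLayer hρ hφ δ
  -- The layer function is also positive below the graph and the graph description of `Ω` is only
  -- local, so a cut-off is needed. It is `1` on the part of the layer inside `Ω` and does not enter
  -- the estimates.
  let χ : ContDiffBump x := ⟨r / 2, r, by positivity, by linarith⟩
  let u : Euc (n + 1) → ℝ := fun z => χ z * max 0 (p (Φ z)) ^ 2
  have hu0 : ∀ z, 0 ≤ u z := fun z => mul_nonneg χ.nonneg (by positivity)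
  have hu : ContDiff ℝ 1 u :=
    χ.contDiff.mul (contDiff_max_zero_sq.comp ((hpc.of_le (by simp)).comp hΦc))
  have huc : HasCompactSupport u := χ.hasCompactSupport.mul_right
  have husymm : ∀ w, Φ.symm w ∈ Metric.ball x (r / 2) → u (Φ.symm w) = max 0 (p w) ^ 2 := by
    intro w hw
    simp only [u, χ.one_of_mem_closedBall (Metric.ball_subset_closedBall hw),
      Φ.apply_symm_apply, one_mul]
  -- A zero of the nonnegative function `u` is a minimum.
  have hzero : ∀ z, u z = 0 → fderiv ℝ u z = 0 := fun z hz =>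
    IsLocalMin.fderiv_eq_zero (Eventually.of_forall fun w => by
      rw [hz]
      exact hu0 w)
  -- Here `|y| < s`, `|ρ(y)| < s` and `0 < t - ρ(y) < δ φ(y) ≤ s`, so the point lies within `3 s ≤ r
  -- / 2` of `x`; this is the origin of `6 s ≤ r`.
  have hnear : ∀ z ∈ Ω, u z ≠ 0 →
      ρ (Φ z).fst < (Φ z).snd ∧ 0 < p (Φ z) ∧ z ∈ Metric.ball x (r / 2) := by
    intro z hz huz
    have hzr : z ∈ Metric.ball x r := by
      rw [show r = χ.rOut from rfl, ← χ.support_eq]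
      exact left_ne_zero_of_mul huz
    have ht := ((hloc z hzr).1).1 hz
    have hp : 0 < p (Φ z) := by
      by_contra h
      exact huz (by simp [u, max_eq_left (not_lt.1 h)])
    refine ⟨ht, hp, ?_⟩
    have hp' : ((Φ z).snd - ρ (Φ z).fst) / δ < φ (Φ z).fst := sub_pos.1 hp
    have hφz : φ (Φ z).fst ≠ 0 := ((div_pos (sub_pos.2 ht) hδ).trans hp').ne'
    have hy := hsupp _ hφz
    have hρy := abs_lt.1 (abs_le_of_norm_fderiv_le hρ hρ0 hslope hy)
    rw [div_lt_iff₀ hδ] at hp'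
    have hδφ : φ (Φ z).fst * δ ≤ s := (mul_le_of_le_one_left hδ.le (h1 _)).trans hδs
    have hts : |(Φ z).snd| < 2 * s := abs_lt.2 ⟨by linarith, by linarith⟩
    rw [Metric.mem_ball, dist_eq_norm_affineIsometryEquiv hx]
    have := norm_eucProd_le (Φ z)
    linarith
  have hfd : ∀ z ∈ Ω, u z ≠ 0 → u z = max 0 (p (Φ z)) ^ 2 ∧
      ∀ v, fderiv ℝ u z v =
        2 * max 0 (p (Φ z)) * fderiv ℝ p (Φ z) (Φ.linearIsometryEquiv v) := by
    intro z hz huz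
    have heq : u =ᶠ[𝓝 z] fun z => max 0 (p (Φ z)) ^ 2 := by
      filter_upwards [χ.eventuallyEq_one_of_mem_ball (hnear z hz huz).2.2] with w hw
      simp only [u, hw, Pi.one_apply, one_mul]
    refine ⟨heq.self_of_nhds, fun v => ?_⟩
    have hp' : HasFDerivAt (fun z => p (Φ z)) _ z :=
      (hpc.differentiable (by simp) (Φ z)).hasFDerivAt.comp z (hΦd z)
    have hq := (hasDerivAt_max_zero_sq (p (Φ z))).comp_hasFDerivAt z hp'
    have hcomp : fderiv ℝ (fun z => max 0 (p (Φ z)) ^ 2) z = _ := hq.fderiv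
    rw [heq.fderiv_eq, hcomp]
    rfl
  let H : EucProd n → ℝ≥0∞ := fun w => ENNReal.ofReal
      (2 * max 0 (p w) * (√(1 + ‖gradient ρ w.fst + δ • gradient φ w.fst‖ ^ 2) / δ) +
        max 0 (p w) ^ 2)
  have hbound : ∀ z ∈ Ω, ‖fderiv ℝ u z‖ₑ + ‖u z‖ₑ ≤
      {w : EucProd n | ρ w.fst < w.snd}.indicator H (Φ z) := by
    intro z hz
    by_cases huz : u z = 0
    · rw [← ofReal_norm, huz, hzero z huz, norm_zero, enorm_zero, ENNReal.ofReal_zero, add_zero]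
      exact zero_le
    obtain ⟨ht, -, -⟩ := hnear z hz huz
    obtain ⟨huz', hfdz⟩ := hfd z hz huz
    rw [Set.indicator_of_mem (show Φ z ∈ {w : EucProd n | ρ w.fst < w.snd} from ht),
      ← ofReal_norm, ← ofReal_norm,
      ← ENNReal.ofReal_add (norm_nonneg _) (norm_nonneg _)]
    refine ENNReal.ofReal_le_ofReal (add_le_add ?_ ?_)
    · refine ContinuousLinearMap.opNorm_le_bound _ (by positivity) fun v => ?_
      rw [hfdz, norm_mul, Real.norm_of_nonneg (by positivity : 0 ≤ 2 * max 0 (p (Φ z))),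
        mul_assoc (2 * max 0 (p (Φ z)))]
      refine mul_le_mul_of_nonneg_left ?_ (by positivity)
      refine (ContinuousLinearMap.le_opNorm _ _).trans ?_
      rw [LinearIsometryEquiv.norm_map]
      exact mul_le_mul_of_nonneg_right (norm_fderiv_graphLayer_le hρ hφ hδ _) (norm_nonneg _)
    · rw [huz', Real.norm_of_nonneg (by positivity)]
  have hupper : (∫⁻ z in Ω, ‖fderiv ℝ u z‖ₑ) + ∫⁻ z in Ω, ‖u z‖ₑ ≤
      ENNReal.ofReal (∫ y, (φ y ^ 2 * √(1 + ‖gradient ρ y + δ • gradient φ y‖ ^ 2) +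
        δ * (φ y ^ 3 / 3))) := by
    have hS : MeasurableSet {w : EucProd n | ρ w.fst < w.snd} :=
      (isOpen_lt (hρ.continuous.comp (by fun_prop)) (by fun_prop)).measurableSet
    rw [← lintegral_add_left (hu.continuous_fderiv one_ne_zero).enorm.measurable]
    calc ∫⁻ z in Ω, (‖fderiv ℝ u z‖ₑ + ‖u z‖ₑ)
        ≤ ∫⁻ z in Ω, {w : EucProd n | ρ w.fst < w.snd}.indicator H (Φ z) :=
          setLIntegral_mono' hΩ.measurableSet hbound
      _ ≤ ∫⁻ z, {w : EucProd n | ρ w.fst < w.snd}.indicator H (Φ z) := setLIntegral_le_lintegral _ _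
      _ = ∫⁻ w, {w : EucProd n | ρ w.fst < w.snd}.indicator H w :=
          (measurePreserving_isometryEquiv Φ).lintegral_comp_emb
            Φ.toHomeomorph.measurableEmbedding _
      _ = ∫⁻ w in {w : EucProd n | ρ w.fst < w.snd}, H w := lintegral_indicator hS _
      _ ≤ _ := lintegral_graphLayer_le hρ hφ hc h0 hδ
  -- On the boundary graph over the `s`-ball `u` equals `φ²`; the rest of the frontier can only
  -- increase the integral.
  have hlower : ENNReal.ofReal (∫ y, φ y ^ 2 * √(1 + ‖gradient ρ y‖ ^ 2)) ≤
      ∫⁻ z in frontier Ω, ‖u z‖ₑ ∂(μHE[n] : Measure (Euc (n + 1))) := by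
    have hball : ∀ y ∈ Metric.ball (0 : Euc n) s,
        Φ.symm (graphMap ρ y) ∈ Metric.ball x (r / 2) := by
      intro y hy
      have hy' := mem_ball_zero_iff.1 hy
      rw [Metric.mem_ball, dist_eq_norm_affineIsometryEquiv hx, Φ.apply_symm_apply]
      have h2 : ‖graphMap ρ y‖ ≤ ‖y‖ + |ρ y| := norm_eucProd_le (graphMap ρ y)
      have h3 := abs_le_of_norm_fderiv_le hρ hρ0 hslope hy'
      linarith [norm_nonneg y]
    have hint : Integrable fun y => φ y ^ 2 * √(1 + ‖gradient ρ y‖ ^ 2) := by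
      simpa using integrable_area_integrand hρ hφ hc 0
    refine le_trans (le_of_eq ?_) (lintegral_graph_le (hρ.of_le (by simp))
      (convex_ball (0 : Euc n) s) measurableSet_ball (by norm_num : (1 / 2 : ℝ) < 1) hslope
      (ι := Φ.symm) Φ.symm.isometry (S := frontier Ω) (fun y hy => ?_)
      hu.continuous.enorm.measurable)
    · rw [ofReal_integral_eq_lintegral_ofReal hint
        (Eventually.of_forall fun y => by positivity), ← lintegral_indicator measurableSet_ball]
      refine lintegral_congr fun y => ?_
      by_cases hy : y ∈ Metric.ball (0 : Euc n) s
      · have huy : u (Φ.symm (graphMap ρ y)) = φ y ^ 2 := by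
          have hpy : p (graphMap ρ y) = φ y := by
            change φ y - (ρ y - ρ y) / δ = φ y
            rw [sub_self, zero_div, sub_zero]
          rw [husymm _ (hball y hy), hpy, max_eq_right (h0 y)]
        rw [Set.indicator_of_mem hy, huy, ← ofReal_norm,
          Real.norm_of_nonneg (by positivity), ← ENNReal.ofReal_mul (by positivity), mul_comm]
      · have : φ y = 0 := by
          by_contra h
          exact hy (mem_ball_zero_iff.2 (hsupp y h))
        rw [Set.indicator_of_notMem hy, this]
        simp
    · have hmem : Φ.symm (graphMap ρ y) ∈ Metric.ball x r :=
        Metric.ball_subset_ball (by linarith) (hball y hy)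
      rw [(hloc _ hmem).2, Φ.apply_symm_apply]
      rfl
  -- `v` is the upward direction of the local coordinates. In `Ω`, `u` strictly decreases along `v`
  -- wherever it is nonzero, so `∂_v u` has nonzero integral and `u` is not in `W_0^{1,1}`.
  let v : Euc (n + 1) := Φ.linearIsometryEquiv.symm (WithLp.toLp 2 (0, 1))
  have hfv : ∀ z ∈ Ω, u z ≠ 0 → fderiv ℝ u z v < 0 := by
    intro z hz huz
    rw [(hfd z hz huz).2, Φ.linearIsometryEquiv.apply_symm_apply,
      fderiv_graphLayer_apply hρ hφ hδ]
    change 2 * max 0 (p (Φ z)) * ((inner ℝ _ 0 - 1) / δ) < 0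
    rw [inner_zero_right, zero_sub]
    have hp := (hnear z hz huz).2.1
    rw [max_eq_right hp.le]
    exact mul_neg_of_pos_of_neg (by positivity) (div_neg_of_neg_of_pos (by norm_num) hδ)
  have hfv' : ∀ z ∈ Ω, fderiv ℝ u z v ≤ 0 := by
    intro z hz
    by_cases huz : u z = 0
    · rw [hzero z huz, zero_apply]
    · exact (hfv z hz huz).le
  -- The witness is halfway up the layer above `x`, where the layer function equals `φ(0) / 2`.
  obtain ⟨z₀, hz₀, huz₀⟩ : ∃ z ∈ Ω, u z ≠ 0 := by
    have hs : 0 < s := hδ.trans_le hδs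
    have hh : 0 < δ * φ 0 / 2 := by positivity
    have hle : δ * φ 0 ≤ s := (mul_le_of_le_one_right hδ.le (h1 0)).trans hδs
    have hb : Φ.symm (WithLp.toLp 2 (0, δ * φ 0 / 2)) ∈ Metric.ball x (r / 2) := by
      rw [Metric.mem_ball, dist_eq_norm_affineIsometryEquiv hx, Φ.apply_symm_apply]
      refine (norm_eucProd_le _).trans_lt ?_
      change ‖(0 : Euc n)‖ + |δ * φ 0 / 2| < r / 2
      rw [norm_zero, zero_add, abs_of_pos hh]
      linarith
    refine ⟨Φ.symm (WithLp.toLp 2 (0, δ * φ 0 / 2)), ?_, ?_⟩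
    · rw [(hloc _ (Metric.ball_subset_ball (by linarith) hb)).1, Φ.apply_symm_apply]
      change ρ 0 < δ * φ 0 / 2
      rwa [hρ0]
    · have : 0 < p (WithLp.toLp 2 (0, δ * φ 0 / 2)) := by
        change 0 < φ 0 - (δ * φ 0 / 2 - ρ 0) / δ
        rw [hρ0]
        field_simp
        linarith
      rw [husymm _ hb, max_eq_right this.le]
      positivity
  have hcont : Continuous fun z => fderiv ℝ u z v :=
    (hu.continuous_fderiv one_ne_zero).clm_apply continuous_const
  refine lambdaOne_lt_one_of_contDiff hu huc (v := v) (fun hint => ?_)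
    (hupper.trans_lt (((ENNReal.ofReal_lt_ofReal_iff_of_nonneg
      (integral_nonneg fun y => ?_)).2 hlt).trans_le hlower))
  · have hI : IntegrableOn (fun z => -fderiv ℝ u z v) Ω :=
      (hcont.neg.integrable_of_hasCompactSupport (huc.fderiv_apply (𝕜 := ℝ) v).neg).integrableOn
    have hpos' : 0 < ∫ z in Ω, -fderiv ℝ u z v := by
      rw [setIntegral_pos_iff_support_of_nonneg_ae
        ((ae_restrict_iff' hΩ.measurableSet).2 (Eventually.of_forall fun z hz => by
          simpa using hfv' z hz)) hI]
      refine (IsOpen.measure_pos volume (hΩ.inter (isOpen_ne_fun hu.continuous continuous_const))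
        ⟨z₀, hz₀, huz₀⟩).trans_le (measure_mono fun z hz => ⟨?_, hz.1⟩)
      exact (neg_pos.2 (hfv z hz.1 hz.2)).ne'
    rw [integral_neg, hint, neg_zero] at hpos'
    exact lt_irrefl _ hpos'
  · have := h0 y
    positivity

end GraphTestFunction

end

/-! ### The main theorem: choice of the bump and of the layer thickness -/

/-- If the boundary of a bounded smooth domain `Ω ⊆ ℝ^N`, `N = n + 1`, has a good point, then
`λ_1(Ω) < 1`. -/
theorem theorem1 (n : ℕ) (Ω : Set (Euc (n + 1))) (hΩ : IsBoundedSmoothDomain Ω)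
    (hgood : ∃ x, IsGoodPoint Ω x) : lambdaOne Ω < 1 := by
  obtain ⟨x, hx, Φ, ρ, r, κ, hg, hprin, -, hκ, -, -⟩ := hgood
  obtain ⟨hΦx, hr, hρ, hloc⟩ := hg
  have hρ0 : ρ 0 = 0 := by
    have := ((hloc x (Metric.mem_ball_self hr)).2).1 hx
    rwa [hΦx] at this
  have hH : ∀ᶠ y in 𝓝 (0 : Euc n), 1 < graphMeanCurvature ρ y :=
    (continuous_graphMeanCurvature hρ).continuousAt.eventually
      (lt_mem_nhds (by rwa [graphMeanCurvature_zero hρ hprin]))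
  have hslope : ∀ᶠ y in 𝓝 (0 : Euc n), ‖fderiv ℝ ρ y‖ < 1 / 2 :=
    (hρ.continuous_fderiv (by simp)).norm.continuousAt.eventually
      (gt_mem_nhds (by simp [hprin.1]))
  obtain ⟨s₀, hs₀, hball⟩ := Metric.eventually_nhds_iff_ball.1 (hH.and hslope)
  -- The bound `s₀` keeps the mean curvature above `1` and the slope below `1 / 2`; the bound `r /
  -- 6` keeps the layer inside the region where the cut-off is `1`.
  set s := min s₀ (r / 6)
  have hs : 0 < s := by positivity
  have hsub : Metric.ball (0 : Euc n) s ⊆ Metric.ball 0 s₀ :=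
    Metric.ball_subset_ball (min_le_left _ _)
  let φ : ContDiffBump (0 : Euc n) := ⟨s / 2, s, by positivity, by linarith⟩
  have hsupp : ∀ y, φ y ≠ 0 → y ∈ Metric.ball (0 : Euc n) s := fun y hy => by
    rw [show s = φ.rOut from rfl, ← φ.support_eq]
    exact hy
  have hpos : 0 < φ 0 := φ.pos_of_mem_ball (Metric.mem_ball_self hs)
  obtain ⟨δ, hlt, hδs, hδ⟩ := ((eventually_integral_area_lt hρ φ.contDiff φ.hasCompactSupport
    (fun y => φ.nonneg) hpos fun y hy => (hball y (hsub (hsupp y hy))).1).and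
      (((eventually_lt_nhds hs).filter_mono nhdsWithin_le_nhds).and self_mem_nhdsWithin)).exists
  exact lambdaOne_lt_one_of_isLocalGraph hΩ.1 ⟨hΦx, hr, hρ, hloc⟩ hρ0 φ.contDiff
    φ.hasCompactSupport (fun y => φ.nonneg) (fun y => φ.le_one) hpos
    (by linarith [min_le_right s₀ (r / 6)]) (fun y hy => mem_ball_zero_iff.1 (hsupp y hy))
    (fun y hy => (hball y (hsub hy)).2.le) hδ hδs.le hlt
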